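/- Let $\omega:[0,1]\to\mathbb{R}$ be continuous and not constant. For $p\ge 1$ let $V_p(\omega)=\sup\sum_i|\omega(t_{i+1})-\omega(t_i)|^p\in[0,\infty]$, the supremum being over all finite subdivisions $(t_i)$ of $[0,1]$, and let $\mathcal{V}(\omega)=\inf\{p\ge 1: V_p(\omega)<\infty\}$ (with $\inf\varnothing=+\infty$). Put $\delta(s,t)=\omega(s)+\omega(t)-2\inf_{[s,t]}\omega$, where $[s,t]$ is the interval with endpoints $s$ and $t$. This is a semi-distance on $[0,1]$; let $(\mathbb{T},\delta)$ be the quotient metric space (a compact real tree) and $\pi:[0,1]\to\mathbb{T}$ the projection. The root is $O=\pi(U)$, where $U$ is any time at which $\omega$ is minimal. A point $\sigma$ is above $\tau$ if $\tau\in[O,\sigma]$. The level of $\tau$ is $\ell(\tau)=\inf\omega+\delta(O,\tau)$, and its height is $h(\tau)=\sup\{\ell(\sigma)-\ell(\tau):\sigma\text{ above }\tau\}$. The leaves of $\mathbb{T}$ are the points with no other point above them, and the skeleton is the set of points that are not leaves. Let $\lambda$ be the length measure on $\mathbb{T}$, that is, one-dimensional Hausdorff measure restricted to the skeleton (leaves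 have measure zero, and the measure of an arc is its length). For $a>0$ let $\mathbb{T}^a=\{\tau: h(\tau)\ge a\}$ be the trimmed tree, $L^a=\lambda(\mathbb{T}^a)$ its length, and $N^a$ the number of its leaves, i.e. of the points of $\mathbb{T}^a$ with no other point of $\mathbb{T}^a$ above them. Let $$\mathcal{H}(\mathbb{T})=\inf\Big\{p\ge1:\int_{\mathbb{T}}h(\tau)^{p-1}\,\lambda(d\tau)<\infty\Big\},\qquad \overline{\dim}\,\mathbb{T}=\limsup_{a\downarrow0}\frac{\log\mathcal{N}(a)}{\log(1/a)},$$ where $\inf\varnothing=+\infty$ and $\mathcal{N}(a)$ is the minimal number of closed balls of radius $a$ needed to cover $\mathbb{T}$. Then, in $[1,+\infty]$, $$\mathcal{V}(\omega)=\mathcal{H}(\mathbb{T})=\limsup_{a\downarrow0}\frac{\log L^a}{\log(1/a)}+1=\Big(\limsup_{a\downarrow0}\frac{\log N^a}{\log(1/a)}\Big)\vee1=\overline{\dim}\,\mathbb{T}.$$ Consequently $V_p(\omega)=\infty$ if $1\le p<\overline{\dim}\,\mathbb{T}$, and $V_p(\omega)<\infty$ if $p>\overline{\dim}\,\mathbb{T}$.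 -/

import Mathlib

open Set Filter Topology MeasureTheory

noncomputable section

namespace PathTree

/-- The infimum of the path `ω` on the closed interval with endpoints `s` and `t`
(in either order). -/
def infOn (ω : C(unitInterval, ℝ)) (s t : unitInterval) : ℝ :=
  sInf (ω '' uIcc s t)

/-- `δ(s, t) = ω(s) + ω(t) - 2 inf_{[s,t]} ω`. -/
def delta (ω : C(unitInterval, ℝ)) (s t : unitInterval) : ℝ :=
  ω s + ω t - 2 * infOn ω s t

theorem bddBelow_image (ω : C(unitInterval, ℝ)) (S : Set unitInterval) :
    BddBelow (ω '' S) :=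
  (isCompact_range ω.continuous).bddBelow.mono (image_subset_range _ _)

theorem infOn_le (ω : C(unitInterval, ℝ)) {s t u : unitInterval} (hu : u ∈ uIcc s t) :
    infOn ω s t ≤ ω u :=
  csInf_le (bddBelow_image ω _) (mem_image_of_mem _ hu)

theorem exists_infOn_eq (ω : C(unitInterval, ℝ)) (s t : unitInterval) :
    ∃ u ∈ uIcc s t, ω u = infOn ω s t := by
  have hne : (ω '' uIcc s t).Nonempty := nonempty_uIcc.image _
  obtain ⟨u, hu, h⟩ := ((isCompact_uIcc (a := s) (b := t)).image ω.continuous).sInf_mem hne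
  exact ⟨u, hu, h⟩

theorem delta_self (ω : C(unitInterval, ℝ)) (s : unitInterval) : delta ω s s = 0 := by
  simp only [delta, infOn, uIcc_self, image_singleton, csInf_singleton]
  ring

theorem delta_comm (ω : C(unitInterval, ℝ)) (s t : unitInterval) :
    delta ω s t = delta ω t s := by
  simp only [delta, infOn, uIcc_comm s t]
  ring

theorem delta_triangle (ω : C(unitInterval, ℝ)) (s t u : unitInterval) :
    delta ω s u ≤ delta ω s t + delta ω t u := by
  obtain ⟨v, hv, hvu⟩ := exists_infOn_eq ω s u
  have h1 : infOn ω s t ≤ ω t := infOn_le ω right_mem_uIcc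
  have h2 : infOn ω t u ≤ ω t := infOn_le ω left_mem_uIcc
  simp only [delta]
  rcases uIcc_subset_uIcc_union_uIcc (b := t) hv with h | h
  · have := infOn_le ω h
    linarith
  · have := infOn_le ω h
    linarith

/-- The time interval `[0,1]`, to be equipped with the semi-distance `δ` of the path `ω`. -/
def TimeSpace (_ω : C(unitInterval, ℝ)) : Type := unitInterval

instance instPseudoMetricSpaceTimeSpace (ω : C(unitInterval, ℝ)) :
    PseudoMetricSpace (TimeSpace ω) where
  dist := delta ω
  dist_self := delta_self ω
  dist_comm := delta_comm ω
  dist_triangle := delta_triangle ω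

/-- The tree `𝕋 = [0,1]/δ` of the path `ω`: points at `δ`-distance zero are identified. -/
def Tree (ω : C(unitInterval, ℝ)) : Type := SeparationQuotient (TimeSpace ω)

instance instMetricSpaceTree (ω : C(unitInterval, ℝ)) : MetricSpace (Tree ω) :=
  inferInstanceAs (MetricSpace (SeparationQuotient (TimeSpace ω)))

instance instMeasurableSpaceTree (ω : C(unitInterval, ℝ)) : MeasurableSpace (Tree ω) :=
  borel (Tree ω)

instance instBorelSpaceTree (ω : C(unitInterval, ℝ)) : BorelSpace (Tree ω) := ⟨rfl⟩

/-- The projection `π : [0,1] → 𝕋`. -/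
def proj (ω : C(unitInterval, ℝ)) (t : unitInterval) : Tree ω :=
  SeparationQuotient.mk (X := TimeSpace ω) t

theorem dist_proj (ω : C(unitInterval, ℝ)) (s t : unitInterval) :
    dist (proj ω s) (proj ω t) = delta ω s t := rfl

theorem exists_argmin (ω : C(unitInterval, ℝ)) : ∃ u : unitInterval, ∀ t, ω u ≤ ω t := by
  obtain ⟨u, -, hu⟩ := isCompact_univ.exists_isMinOn (univ_nonempty (α := unitInterval))
    ω.continuous.continuousOn
  exact ⟨u, fun t => hu (mem_univ t)⟩

/-- The root `O = π(U)`, where `U` is a time at which `ω` is minimal; any two such times are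
at `δ`-distance zero, so `O` does not depend on the choice. -/
def root (ω : C(unitInterval, ℝ)) : Tree ω := proj ω (exists_argmin ω).choose

theorem root_eq (ω : C(unitInterval, ℝ)) (u : unitInterval) (hu : ∀ t, ω u ≤ ω t) :
    root ω = proj ω u := by
  have hc := (exists_argmin ω).choose_spec
  refine dist_le_zero.mp ?_
  rw [root, dist_proj, delta]
  obtain ⟨v, -, hv⟩ := exists_infOn_eq ω (exists_argmin ω).choose u
  have h1 := hc v
  have h2 := hu v
  linarith

/-- The level function `ℓ(τ) = inf ω + δ(O, τ)`. -/
def level (ω : C(unitInterval, ℝ)) (τ : Tree ω) : ℝ := (⨅ t, ω t) + dist (root ω) τ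

/-- The arc `[τ₁, τ₂]` of the real tree: the points lying between `τ₁` and `τ₂`. -/
def arc {ω : C(unitInterval, ℝ)} (τ₁ τ₂ : Tree ω) : Set (Tree ω) :=
  {σ | dist τ₁ σ + dist σ τ₂ = dist τ₁ τ₂}

/-- The set of points `σ` above `τ`, i.e. such that `τ ∈ [O, σ]` (it contains `τ` itself). -/
def above {ω : C(unitInterval, ℝ)} (τ : Tree ω) : Set (Tree ω) :=
  {σ | τ ∈ arc (root ω) σ}

/-- The height `h(τ)` of the part of the tree above `τ`. -/
def height {ω : C(unitInterval, ℝ)} (τ : Tree ω) : ℝ :=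
  sSup ((fun σ => level ω σ - level ω τ) '' above τ)

/-- The leaves of a subtree `A`: the points of `A` with no other point of `A` above them. -/
def leaves {ω : C(unitInterval, ℝ)} (A : Set (Tree ω)) : Set (Tree ω) :=
  {τ | τ ∈ A ∧ ∀ σ ∈ A, σ ∈ above τ → σ = τ}

/-- The skeleton of the tree: the points which are not leaves. -/
def skeleton (ω : C(unitInterval, ℝ)) : Set (Tree ω) := (leaves univ)ᶜ

/-- The length measure `λ` of the tree: one-dimensional Hausdorff measure (normalized so that
the measure of a segment is its length) restricted to the skeleton. -/
def lengthMeasure (ω : C(unitInterval, ℝ)) : Measure (Tree ω) :=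
  (Measure.hausdorffMeasure 1).restrict (skeleton ω)

/-- The trimmed tree `𝕋^a`. -/
def trim (ω : C(unitInterval, ℝ)) (a : ℝ) : Set (Tree ω) := {τ | a ≤ height τ}

/-- The total length `L^a` of the trimmed tree. -/
def trimLength (ω : C(unitInterval, ℝ)) (a : ℝ) : ENNReal := lengthMeasure ω (trim ω a)

/-- The number `N^a` of leaves of the trimmed tree. -/
def trimLeaves (ω : C(unitInterval, ℝ)) (a : ℝ) : ℕ∞ := (leaves (trim ω a)).encard

/-- The `p`-variation `V_p(ω)`: the supremum over finite sequences
`t 0 ≤ t 1 ≤ ... ≤ t n` in `[0,1]` of `∑ |ω (t (i+1)) - ω (t i)| ^ p`. -/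
def pVariation (p : ℝ) (ω : C(unitInterval, ℝ)) : ENNReal :=
  ⨆ (n : ℕ) (t : ℕ → unitInterval) (_ : Monotone t),
    ∑ i ∈ Finset.range n, ENNReal.ofReal (|ω (t (i + 1)) - ω (t i)| ^ p)

/-- The variation index `inf {p ≥ 1 ; V_p(ω) < ∞}` (which is `⊤` if there is no such `p`). -/
def variationIndex (ω : C(unitInterval, ℝ)) : EReal :=
  sInf {x : EReal | ∃ p : ℝ, 1 ≤ p ∧ pVariation p ω < ⊤ ∧ x = p}

/-- The index `inf {p ≥ 1 ; ∫ h^{p-1} dλ < ∞}` (which is `⊤` if there is no such `p`). -/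
def heightIndex (ω : C(unitInterval, ℝ)) : EReal :=
  sInf {x : EReal | ∃ p : ℝ, 1 ≤ p ∧
    ∫⁻ τ, ENNReal.ofReal (height τ ^ (p - 1)) ∂(lengthMeasure ω) < ⊤ ∧ x = p}

/-- `limsup_{a ↓ 0} log f(a) / log (1/a)`, computed in the extended reals. -/
def growthExponent (f : ℝ → ENNReal) : EReal :=
  limsup (fun a : ℝ => ENNReal.log (f a) / ((Real.log (1 / a) : ℝ) : EReal)) (𝓝[>] (0 : ℝ))

/-- The upper box dimension of a metric space `X`, where `𝒩(a)` is the minimal number of closed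
balls of radius `a` needed to cover `X`. -/
def upperBoxDim (X : Type*) [MetricSpace X] : EReal :=
  growthExponent (fun a => (Metric.coveringNumber a.toNNReal (univ : Set X) : ENNReal))

end PathTree

end

namespace PathTree

variable {ω : C(unitInterval, ℝ)}

/-! Write V, H, L, N, D for the variation index, the height index, the growth exponents of the
trimmed length and of the leaf count, and the box dimension. The theorem follows from the cycle V ≤
H ≤ N ∨ 1 ≤ D ≤ V, into which L enters by N ∨ 1 ≤ L + 1 ≤ H.

V ≤ H: an increment Δ of the path gives a segment of the tree of length Δ/2 on which the height is
at least Δ/2, so it contributes at least (Δ/2)^p to the integral of h^(p-1). Segments coming from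
increments of the same sign are disjoint (`pVariation_le_lintegral`). H ≤ N ∨ 1: the points of
height in [a, 2a) lie on segments of length a hanging below the leaves of the tree trimmed at a.
Summing over dyadic a bounds the integral (`lintegral_height_rpow_lt_top`). N ∨ 1 ≤ D: highest
points above distinct leaves of a trimmed tree are far apart (`trimLeaves_le_coveringNumber`). D ≤
V: between two times at δ-distance at least a, the path makes a move of at least a/2
(`coveringNumber_mul_rpow_le`). L + 1 ≤ H is Markov's inequality, and N ≤ L + 1 because each leaf of
the tree trimmed at 2a carries its own segment of length a (`ofReal_mul_trimLeaves_le`). The bounds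
by 1 from below hold because a non-constant path has a tree of positive height. -/

theorem le_infOn {s t : unitInterval} {c : ℝ} (h : ∀ u ∈ uIcc s t, c ≤ ω u) :
    c ≤ infOn ω s t := by
  obtain ⟨u, hu, hu'⟩ := exists_infOn_eq ω s t
  exact hu' ▸ h u hu

theorem exists_proj_eq (τ : Tree ω) : ∃ t, proj ω t = τ := Quot.exists_rep τ

theorem dist_le_of_mem_uIcc {s t u : unitInterval} (hu : u ∈ uIcc s t) :
    dist u s ≤ dist t s := by
  rw [Subtype.dist_eq, Subtype.dist_eq, Real.dist_eq, Real.dist_eq]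
  rcases mem_uIcc.1 hu with ⟨h1, h2⟩ | ⟨h1, h2⟩
  · rw [← Subtype.coe_le_coe] at h1 h2
    rw [abs_of_nonneg (by linarith), abs_of_nonneg (by linarith)]
    linarith
  · rw [← Subtype.coe_le_coe] at h1 h2
    rw [abs_of_nonpos (by linarith), abs_of_nonpos (by linarith)]
    linarith

theorem continuous_proj (ω : C(unitInterval, ℝ)) : Continuous (proj ω) := by
  rw [Metric.continuous_iff]
  intro s ε hε
  obtain ⟨η, hη, h⟩ := Metric.continuous_iff.1 ω.continuous s (ε / 4) (by positivity)
  refine ⟨η, hη, fun t ht => ?_⟩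
  obtain ⟨u, hu, hu'⟩ := exists_infOn_eq ω s t
  have h1 := h t ht
  have h2 := h u ((dist_le_of_mem_uIcc hu).trans_lt ht)
  rw [Real.dist_eq, abs_lt] at h1 h2
  rw [dist_comm, dist_proj, delta, ← hu']
  linarith

instance instCompactSpaceTree (ω : C(unitInterval, ℝ)) : CompactSpace (Tree ω) := by
  have h : range (proj ω) = univ := eq_univ_of_forall exists_proj_eq
  exact ⟨h ▸ isCompact_range (continuous_proj ω)⟩

/-! ### Levels and the genealogical order. -/

/-- A time at which `ω` is minimal. -/
noncomputable def argmin (ω : C(unitInterval, ℝ)) : unitInterval := (exists_argmin ω).choose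

theorem argmin_le (t : unitInterval) : ω (argmin ω) ≤ ω t := (exists_argmin ω).choose_spec t

theorem root_eq_proj_argmin (ω : C(unitInterval, ℝ)) : root ω = proj ω (argmin ω) := rfl

theorem infOn_argmin (t : unitInterval) : infOn ω (argmin ω) t = ω (argmin ω) :=
  le_antisymm (infOn_le ω left_mem_uIcc) (le_infOn fun u _ => argmin_le u)

theorem iInf_eq (ω : C(unitInterval, ℝ)) : ⨅ t, ω t = ω (argmin ω) :=
  le_antisymm (ciInf_le (by simpa using bddBelow_image ω univ) _) (le_ciInf argmin_le)

theorem level_proj (t : unitInterval) : level ω (proj ω t) = ω t := by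
  rw [level, iInf_eq, root_eq_proj_argmin, dist_proj, delta, infOn_argmin]
  ring

theorem level_root : level ω (root ω) = ω (argmin ω) := level_proj _

theorem level_root_le (τ : Tree ω) : level ω (root ω) ≤ level ω τ := by
  simp [level, dist_nonneg]

theorem abs_level_sub_le (σ τ : Tree ω) : |level ω σ - level ω τ| ≤ dist σ τ := by
  have : level ω σ - level ω τ = dist σ (root ω) - dist τ (root ω) := by
    simp only [level, dist_comm]; ring
  rw [this]
  exact abs_dist_sub_le _ _ _

theorem lipschitzWith_level (ω : C(unitInterval, ℝ)) : LipschitzWith 1 (level ω) :=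
  LipschitzWith.of_dist_le_mul fun σ τ => by
    simpa [Real.dist_eq] using abs_level_sub_le σ τ

theorem continuous_level (ω : C(unitInterval, ℝ)) : Continuous (level ω) :=
  (lipschitzWith_level ω).continuous

theorem mem_above_iff {σ τ : Tree ω} : σ ∈ above τ ↔ dist τ σ = level ω σ - level ω τ := by
  simp only [above, arc, mem_ofPred_eq, level]
  constructor <;> intro h <;> linarith

theorem level_le_of_mem_above {σ τ : Tree ω} (h : σ ∈ above τ) : level ω τ ≤ level ω σ := by
  have := mem_above_iff.1 h
  have := dist_nonneg (x := τ) (y := σ)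
  linarith

theorem self_mem_above (τ : Tree ω) : τ ∈ above τ := by simp [mem_above_iff]

theorem mem_above_root (τ : Tree ω) : τ ∈ above (root ω) := by
  simp [mem_above_iff, level]

theorem above_trans {x y z : Tree ω} (hxy : y ∈ above x) (hyz : z ∈ above y) : z ∈ above x := by
  rw [mem_above_iff] at *
  have := dist_triangle x y z
  have := (abs_le.1 (abs_level_sub_le x z)).1
  linarith

theorem eq_of_mem_above {σ τ : Tree ω} (h : σ ∈ above τ) (hl : level ω σ ≤ level ω τ) : σ = τ := by
  rw [mem_above_iff] at h
  exact (dist_le_zero.1 (h.trans_le (by linarith))).symm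

/-- The distance is the difference of levels exactly when the infimum between the two times is
attained at `r`. This turns the order of the tree into a statement on the path. -/
theorem proj_mem_above_proj {r s : unitInterval} :
    proj ω s ∈ above (proj ω r) ↔ ∀ u ∈ uIcc r s, ω r ≤ ω u := by
  rw [mem_above_iff, dist_proj, level_proj, level_proj, delta]
  constructor
  · intro h u hu
    have := infOn_le ω hu
    linarith
  · intro h
    have h1 := le_infOn h
    have h2 := infOn_le ω (left_mem_uIcc (a := r) (b := s))
    linarith

theorem forall_uIcc_of_forall_uIcc {P : unitInterval → Prop} {r s t : unitInterval}
    (h1 : ∀ u ∈ uIcc r s, P u) (h2 : ∀ u ∈ uIcc s t, P u) : ∀ u ∈ uIcc r t, P u := fun u hu =>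
  (uIcc_subset_uIcc_union_uIcc (b := s) hu).elim (h1 u) (h2 u)

/-- The points below a given point are totally ordered. -/
theorem mem_above_of_level_le {x y z : Tree ω} (hx : z ∈ above x) (hy : z ∈ above y)
    (hl : level ω x ≤ level ω y) : y ∈ above x := by
  obtain ⟨r, rfl⟩ := exists_proj_eq x
  obtain ⟨s, rfl⟩ := exists_proj_eq y
  obtain ⟨t, rfl⟩ := exists_proj_eq z
  rw [level_proj, level_proj] at hl
  rw [proj_mem_above_proj] at *
  refine forall_uIcc_of_forall_uIcc hx fun u hu => hl.trans (hy u ?_)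
  rwa [uIcc_comm]

theorem dist_eq_of_mem_above {x y z : Tree ω} (hx : z ∈ above x) (hy : z ∈ above y) :
    dist x y = |level ω x - level ω y| := by
  rcases le_total (level ω x) (level ω y) with h | h
  · rw [mem_above_iff.1 (mem_above_of_level_le hx hy h), abs_sub_comm, abs_of_nonneg (by linarith)]
  · rw [dist_comm, mem_above_iff.1 (mem_above_of_level_le hy hx h), abs_of_nonneg (by linarith)]

/-- If `y` is above `x`, `y'` is above `x'` and `y`, `y'` are close to each other relatively to
their levels above `x`, then `x` and `x'` are comparable. -/
theorem mem_above_of_dist_lt {x x' y y' : Tree ω} (hy : y ∈ above x) (hy' : y' ∈ above x')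
    (hl : level ω x ≤ level ω x')
    (hd : dist y y' < level ω y + level ω y' - 2 * level ω x) : x' ∈ above x := by
  obtain ⟨r, rfl⟩ := exists_proj_eq x
  obtain ⟨r', rfl⟩ := exists_proj_eq x'
  obtain ⟨s, rfl⟩ := exists_proj_eq y
  obtain ⟨s', rfl⟩ := exists_proj_eq y'
  simp only [level_proj, dist_proj, delta] at hd hl
  rw [proj_mem_above_proj] at *
  have h1 : ∀ u ∈ uIcc s s', ω r ≤ ω u := fun u hu => by
    have := infOn_le ω hu
    linarith
  refine forall_uIcc_of_forall_uIcc hy (forall_uIcc_of_forall_uIcc h1 fun u hu => ?_)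
  exact hl.trans (hy' u (by rwa [uIcc_comm]))

/-- Take for `u` the time of value `v` closest to `s`: if the path went below `v` between `u` and
`s`, the intermediate value theorem would give a closer one. This produces the ancestor of `π(s)` at
level `v`. -/
theorem exists_le_of_mem_uIcc {r s : unitInterval} {v : ℝ} (hr : ω r ≤ v) (hs : v ≤ ω s) :
    ∃ u, ω u = v ∧ ∀ w ∈ uIcc u s, v ≤ ω w := by
  have hivt : ∀ w, ω w ≤ v → ∃ u ∈ uIcc w s, ω u = v := fun w hw =>
    intermediate_value_uIcc (f := ω) ω.continuous.continuousOn
      (Icc_subset_uIcc ⟨hw, hs⟩)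
  have hK : IsCompact {u | ω u = v} :=
    (isClosed_eq ω.continuous continuous_const).isCompact
  obtain ⟨u, hu, hmin⟩ := hK.exists_isMinOn (f := fun u => dist u s)
    (by obtain ⟨u, -, h⟩ := hivt r hr; exact ⟨u, h⟩) (by fun_prop)
  refine ⟨u, hu, fun w hw => ?_⟩
  by_contra! hlt
  obtain ⟨w', hw', hv⟩ := hivt w hlt.le
  have h1 : dist u s ≤ dist w' s := hmin hv
  have h2 := dist_le_of_mem_uIcc (uIcc_comm u s ▸ hw)
  have h3 := dist_le_of_mem_uIcc (uIcc_comm w s ▸ hw')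
  have h4 : dist w' s = dist w s := by linarith
  -- The time `w'` is between `w` and `s` and as far from `s` as `w`, so they coincide, which
  -- contradicts `ω w < v`.
  have h5 : w' = w := by
    rw [Subtype.dist_eq, Subtype.dist_eq, Real.dist_eq, Real.dist_eq] at h4
    rcases mem_uIcc.1 hw' with ⟨h1, h2⟩ | ⟨h1, h2⟩ <;> rw [← Subtype.coe_le_coe] at h1 h2
    · rw [abs_of_nonpos (by linarith), abs_of_nonpos (by linarith)] at h4
      exact Subtype.ext (by linarith)
    · rw [abs_of_nonneg (by linarith), abs_of_nonneg (by linarith)] at h4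
      exact Subtype.ext (by linarith)
  rw [h5] at hv
  exact hlt.ne hv

theorem exists_below_level_eq (τ : Tree ω) {v : ℝ} (h0 : level ω (root ω) ≤ v)
    (h1 : v ≤ level ω τ) : ∃ σ, τ ∈ above σ ∧ level ω σ = v := by
  obtain ⟨t, rfl⟩ := exists_proj_eq τ
  rw [level_root] at h0
  rw [level_proj] at h1
  obtain ⟨u, hu, h⟩ := exists_le_of_mem_uIcc h0 h1
  exact ⟨proj ω u, proj_mem_above_proj.2 (hu ▸ h), by rw [level_proj, hu]⟩

/-! ### Heights, trimmed trees and their leaves. -/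

theorem isClosed_above_graph (ω : C(unitInterval, ℝ)) :
    IsClosed {q : Tree ω × Tree ω | q.2 ∈ above q.1} := by
  simp only [above, arc, mem_ofPred_eq]
  exact isClosed_eq (by fun_prop) (by fun_prop)

theorem isClosed_above (τ : Tree ω) : IsClosed (above τ) := by
  simp only [above, arc]
  exact isClosed_eq (by fun_prop) (by fun_prop)

theorem isClosed_below (τ : Tree ω) : IsClosed {σ : Tree ω | τ ∈ above σ} := by
  simp only [above, arc, mem_ofPred_eq]
  exact isClosed_eq (by fun_prop) (by fun_prop)

theorem le_height {σ τ : Tree ω} (h : σ ∈ above τ) : level ω σ - level ω τ ≤ height τ :=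
  le_csSup (((isClosed_above τ).isCompact.image
    ((continuous_level ω).sub continuous_const)).bddAbove) (mem_image_of_mem _ h)

theorem exists_height_eq (τ : Tree ω) : ∃ σ ∈ above τ, level ω σ - level ω τ = height τ :=
  ((isClosed_above τ).isCompact.image ((continuous_level ω).sub continuous_const)).sSup_mem
    ⟨_, mem_image_of_mem _ (self_mem_above τ)⟩

theorem height_nonneg (τ : Tree ω) : 0 ≤ height τ := by
  simpa using le_height (self_mem_above τ)

theorem height_le_height_root (τ : Tree ω) : height τ ≤ height (root ω) := by
  obtain ⟨σ, -, h⟩ := exists_height_eq τ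
  have := le_height (mem_above_root σ)
  have := level_root_le τ
  linarith

theorem add_height_le {σ τ : Tree ω} (h : σ ∈ above τ) :
    level ω σ - level ω τ + height σ ≤ height τ := by
  obtain ⟨ρ, hρ, hρ'⟩ := exists_height_eq σ
  have := le_height (above_trans h hρ)
  linarith

theorem skeleton_eq (ω : C(unitInterval, ℝ)) : skeleton ω = {τ | 0 < height τ} := by
  ext τ
  simp only [skeleton, leaves, mem_compl_iff, mem_ofPred_eq, mem_univ, true_and, forall_const,
    not_forall]
  constructor
  · rintro ⟨σ, hσ, hne⟩
    refine lt_of_lt_of_le (sub_pos.2 ?_) (le_height hσ)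
    by_contra! h
    exact hne (eq_of_mem_above hσ h)
  · intro h
    obtain ⟨σ, hσ, hh⟩ := exists_height_eq τ
    refine ⟨σ, hσ, ?_⟩
    rintro rfl
    simp [← hh] at h

/-- Since heights are attained, the trimmed tree is the projection of a compact set of pairs. -/
theorem isClosed_trim (ω : C(unitInterval, ℝ)) (a : ℝ) : IsClosed (trim ω a) := by
  have h : trim ω a = Prod.fst '' ({q : Tree ω × Tree ω | q.2 ∈ above q.1} ∩
      {q | a ≤ level ω q.2 - level ω q.1}) := by
    ext τ
    simp only [trim, mem_ofPred_eq, mem_image, mem_inter_iff, Prod.exists, exists_and_right,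
      exists_eq_right]
    constructor
    · intro h
      obtain ⟨σ, hσ, hh⟩ := exists_height_eq τ
      exact ⟨σ, hσ, hh ▸ h⟩
    · rintro ⟨σ, hσ, h⟩
      exact h.trans (le_height hσ)
  rw [h]
  have := continuous_level ω
  exact (((isClosed_above_graph ω).inter
    (isClosed_le (by fun_prop) (by fun_prop))).isCompact.image continuous_fst).isClosed

theorem measurableSet_trim (ω : C(unitInterval, ℝ)) (a : ℝ) : MeasurableSet (trim ω a) :=
  (isClosed_trim ω a).measurableSet

theorem trim_subset_skeleton {a : ℝ} (ha : 0 < a) : trim ω a ⊆ skeleton ω := fun τ hτ => by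
  rw [skeleton_eq]
  exact ha.trans_le hτ

/-- A point of maximal level in the compact set of points of the trimmed tree above `τ` is a leaf.
-/
theorem exists_leaf_above {a : ℝ} {τ : Tree ω} (hτ : τ ∈ trim ω a) :
    ∃ σ ∈ leaves (trim ω a), σ ∈ above τ := by
  obtain ⟨σ, hσ, hmax⟩ := ((isClosed_above τ).inter (isClosed_trim ω a)).isCompact.exists_isMaxOn
    ⟨τ, self_mem_above τ, hτ⟩ (continuous_level ω).continuousOn
  exact ⟨σ, ⟨hσ.2, fun ρ hρ hρσ => eq_of_mem_above hρσ (hmax ⟨above_trans hσ.1 hρσ, hρ⟩)⟩, hσ.1⟩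

/-! ### Length compared with Lebesgue measure of levels. -/

theorem lengthMeasure_eq_of_subset_trim {a : ℝ} (ha : 0 < a) {A : Set (Tree ω)}
    (hA : A ⊆ trim ω a) : lengthMeasure ω A = Measure.hausdorffMeasure 1 A :=
  Measure.restrict_eq_self _ (hA.trans (trim_subset_skeleton ha))

/-- A set of points below `τ` is no longer than its set of levels. -/
theorem hausdorffMeasure_le_of_below {τ : Tree ω} {A : Set (Tree ω)} {B : Set ℝ}
    (hA : ∀ σ ∈ A, τ ∈ above σ) (hB : ∀ σ ∈ A, level ω σ ∈ B) :
    Measure.hausdorffMeasure 1 A ≤ volume B := by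
  have hf : Isometry (fun σ : A => level ω σ) := Isometry.of_dist_eq fun x y => by
    rw [Real.dist_eq, Subtype.dist_eq, dist_eq_of_mem_above (hA x x.2) (hA y y.2)]
  have h1 := (isometry_subtype_coe (s := A)).hausdorffMeasure_image (d := 1)
    (Or.inl zero_le_one) (univ : Set A)
  have h2 := hf.hausdorffMeasure_image (d := 1) (Or.inl zero_le_one) univ
  rw [image_univ, Subtype.range_coe] at h1
  rw [h1, ← h2, hausdorffMeasure_real]
  refine measure_mono ?_
  rintro _ ⟨x, -, rfl⟩
  exact hB x x.2

/-- A set of points is at least as long as its set of levels. -/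
theorem le_hausdorffMeasure_of_level {A : Set (Tree ω)} {B : Set ℝ}
    (h : ∀ v ∈ B, ∃ σ ∈ A, level ω σ = v) : volume B ≤ Measure.hausdorffMeasure 1 A := by
  have h1 := (lipschitzWith_level ω).hausdorffMeasure_image_le (d := 1) zero_le_one A
  rw [hausdorffMeasure_real] at h1
  simp only [ENNReal.coe_one, ENNReal.one_rpow, one_mul] at h1
  exact (measure_mono h).trans h1

/-! ### Growth exponents and power bounds. -/

theorem eventually_le_of_growthExponent_lt {f : ℝ → ENNReal} {q : ℝ}
    (h : growthExponent f < q) :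
    ∀ᶠ a in 𝓝[>] (0 : ℝ), f a ≤ ENNReal.ofReal (a ^ (-q)) := by
  have h1 := eventually_lt_of_limsup_lt h
  have h2 : ∀ᶠ a in 𝓝[>] (0 : ℝ), a ∈ Ioo (0 : ℝ) 1 := Ioo_mem_nhdsGT one_pos
  filter_upwards [h1, h2] with a ha ⟨ha0, ha1⟩
  have hlog : 0 < Real.log (1 / a) := Real.log_pos (by rw [lt_div_iff₀ ha0]; linarith)
  have h3 := (EReal.div_le_iff_le_mul (by exact_mod_cast hlog) (EReal.coe_ne_top _)).1 ha.le
  rw [← ENNReal.log_le_log_iff, ENNReal.log_ofReal_of_pos (by positivity), Real.log_rpow ha0]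
  refine h3.trans_eq ?_
  rw [← EReal.coe_mul]
  congr 1
  rw [one_div, Real.log_inv]
  ring

/-- For any `q' > q`, the factor `a ^ (q' - q)` tends to zero and absorbs the constant. -/
theorem growthExponent_le {f : ℝ → ENNReal} {q : ℝ} {C : ENNReal} (hC : C ≠ ⊤)
    (h : ∀ᶠ a in 𝓝[>] (0 : ℝ), f a ≤ C * ENNReal.ofReal (a ^ (-q))) :
    growthExponent f ≤ q := by
  rw [← EReal.le_of_forall_lt_iff_le]
  intro q' hq'
  have hq : q < q' := by exact_mod_cast hq'
  have h2 : ∀ᶠ a in 𝓝[>] (0 : ℝ), a ∈ Ioo (0 : ℝ) 1 := Ioo_mem_nhdsGT one_pos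
  have h3 : ∀ᶠ a in 𝓝[>] (0 : ℝ), a ^ (q' - q) * C.toReal ≤ 1 := by
    have : Tendsto (fun a : ℝ => a ^ (q' - q) * C.toReal) (𝓝[>] 0) (𝓝 (0 ^ (q' - q) * C.toReal)) :=
      ((Real.continuousAt_rpow_const 0 (q' - q) (Or.inr (by linarith))).mono_left
        nhdsWithin_le_nhds).mul_const _
    rw [Real.zero_rpow (by linarith), zero_mul] at this
    exact this.eventually_le_const one_pos
  refine limsup_le_of_le (by isBoundedDefault) ?_
  filter_upwards [h, h2, h3] with a ha ⟨ha0, ha1⟩ hC'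
  have hlog : 0 < Real.log (1 / a) := Real.log_pos (by rw [lt_div_iff₀ ha0]; linarith)
  rw [EReal.div_le_iff_le_mul (by exact_mod_cast hlog) (EReal.coe_ne_top _)]
  have h4 : f a ≤ ENNReal.ofReal (a ^ (-q')) := by
    refine ha.trans ?_
    rw [← ENNReal.ofReal_toReal hC, ← ENNReal.ofReal_mul ENNReal.toReal_nonneg]
    refine ENNReal.ofReal_le_ofReal ?_
    have h5 : a ^ (-q) = a ^ (-q') * a ^ (q' - q) := by
      rw [← Real.rpow_add ha0]; congr 1; ring
    rw [h5]
    have := Real.rpow_pos_of_pos ha0 (-q')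
    nlinarith
  refine (ENNReal.log_le_log_iff.2 h4).trans_eq ?_
  rw [ENNReal.log_ofReal_of_pos (by positivity), Real.log_rpow ha0, ← EReal.coe_mul]
  congr 1
  rw [one_div, Real.log_inv]
  ring

theorem one_le_of_eventually_le {c q : ℝ} (hc : 0 < c)
    (h : ∀ᶠ a in 𝓝[>] (0 : ℝ), c ≤ a ^ (1 - q)) : 1 ≤ q := by
  by_contra! hq
  have : Tendsto (fun a : ℝ => a ^ (1 - q)) (𝓝[>] 0) (𝓝 (0 ^ (1 - q))) :=
    (Real.continuousAt_rpow_const 0 (1 - q) (Or.inr (by linarith))).mono_left nhdsWithin_le_nhds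
  rw [Real.zero_rpow (by linarith)] at this
  obtain ⟨a, ha, hb⟩ := (h.and (this.eventually_lt_const hc)).exists
  linarith

theorem eventually_comp_mul {P : ℝ → Prop} {c : ℝ} (hc : 0 < c)
    (h : ∀ᶠ a in 𝓝[>] (0 : ℝ), P a) : ∀ᶠ a in 𝓝[>] (0 : ℝ), P (c * a) := by
  have : Tendsto (fun a : ℝ => c * a) (𝓝[>] 0) (𝓝[>] 0) := by
    refine tendsto_nhdsWithin_iff.2 ⟨?_, ?_⟩
    · have : Tendsto (fun a : ℝ => c * a) (𝓝 0) (𝓝 (c * 0)) := by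
        exact (continuous_const.mul continuous_id).tendsto 0
      rw [mul_zero] at this
      exact this.mono_left nhdsWithin_le_nhds
    · filter_upwards [self_mem_nhdsWithin] with a ha
      exact mul_pos hc ha
  exact this.eventually h

/-! ### Trimmed length against the height integral and the number of leaves. -/

/-- The length of the trimmed tree is controlled by the integral of the height. -/
theorem rpow_mul_trimLength_le {a p : ℝ} (ha : 0 < a) (hp : 1 ≤ p) :
    ENNReal.ofReal (a ^ (p - 1)) * trimLength ω a ≤
      ∫⁻ τ, ENNReal.ofReal (height τ ^ (p - 1)) ∂(lengthMeasure ω) := by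
  rw [trimLength, ← setLIntegral_const]
  refine (setLIntegral_mono' (measurableSet_trim ω a) fun τ hτ => ?_).trans
    (setLIntegral_le_lintegral _ _)
  exact ENNReal.ofReal_le_ofReal (Real.rpow_le_rpow ha.le hτ (by linarith))

theorem growthExponent_trimLength_add_one_le :
    growthExponent (trimLength ω) + 1 ≤ heightIndex ω := by
  refine le_sInf ?_
  rintro _ ⟨p, hp, hint, rfl⟩
  have h : growthExponent (trimLength ω) ≤ ((p - 1 : ℝ) : EReal) := by
    refine growthExponent_le hint.ne ?_
    filter_upwards [self_mem_nhdsWithin] with a ha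
    rw [mem_Ioi] at ha
    have hpos : 0 < a ^ (p - 1) := Real.rpow_pos_of_pos ha _
    rw [Real.rpow_neg ha.le, ENNReal.ofReal_inv_of_pos hpos, ← ENNReal.div_eq_inv_mul.trans
      (mul_comm _ _), ENNReal.le_div_iff_mul_le (Or.inl (by simpa using hpos)) (Or.inl (by simp)),
      mul_comm]
    exact rpow_mul_trimLength_le ha hp
  refine (add_le_add_left h 1).trans_eq ?_
  norm_cast
  simp

/-- Above each leaf of the trimmed tree at level `2 a`, there is a segment of length `a` of the
trimmed tree at level `a`, and these segments are disjoint. -/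
theorem ofReal_mul_trimLeaves_le {a : ℝ} (ha : 0 < a) :
    ENNReal.ofReal a * (trimLeaves ω (2 * a) : ENNReal) ≤ trimLength ω a := by
  choose top htop htop' using fun τ : Tree ω => exists_height_eq τ
  let A : Tree ω → Set (Tree ω) := fun τ =>
    above τ ∩ ({σ | top τ ∈ above σ} ∩ level ω ⁻¹' (Ico (level ω τ) (level ω τ + a)))
  have hmeas : ∀ τ, MeasurableSet (A τ) := fun τ =>
    (isClosed_above τ).measurableSet.inter ((isClosed_below _).measurableSet.inter
      ((continuous_level ω).measurable measurableSet_Ico))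
  have hsub : ∀ τ ∈ leaves (trim ω (2 * a)), A τ ⊆ trim ω a := by
    rintro τ ⟨hτ, -⟩ σ ⟨-, h2, -, h4⟩
    have := le_height h2
    have := htop' τ
    have h5 : 2 * a ≤ height τ := hτ
    change a ≤ height σ
    linarith
  have hlen : ∀ τ ∈ leaves (trim ω (2 * a)), ENNReal.ofReal a ≤ lengthMeasure ω (A τ) := by
    intro τ hτ
    rw [lengthMeasure_eq_of_subset_trim ha (hsub τ hτ)]
    have h5 : 2 * a ≤ height τ := hτ.1
    have h6 := htop' τ
    refine le_trans ?_ (le_hausdorffMeasure_of_level (B := Ico (level ω τ) (level ω τ + a)) ?_)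
    · rw [Real.volume_Ico]; simp
    · rintro v ⟨hv1, hv2⟩
      obtain ⟨σ, hσ, rfl⟩ := exists_below_level_eq (top τ) (v := v)
        ((level_root_le τ).trans hv1) (by linarith)
      exact ⟨σ, ⟨mem_above_of_level_le (htop τ) hσ hv1, hσ, hv1, hv2⟩, rfl⟩
  -- A common point would be above both leaves, which would then be comparable, hence equal.
  have hdisj : (leaves (trim ω (2 * a))).PairwiseDisjoint A := by
    intro τ hτ τ' hτ' hne
    refine Set.disjoint_left.2 fun σ hσ hσ' => hne ?_
    rcases le_total (level ω τ) (level ω τ') with h | h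
    · exact (hτ.2 τ' hτ'.1 (mem_above_of_level_le hσ.1 hσ'.1 h)).symm
    · exact hτ'.2 τ hτ.1 (mem_above_of_level_le hσ'.1 hσ.1 h)
  have hfin : ∀ F : Finset (Tree ω), (F : Set (Tree ω)) ⊆ leaves (trim ω (2 * a)) →
      ENNReal.ofReal a * F.card ≤ trimLength ω a := by
    intro F hF
    calc ENNReal.ofReal a * F.card = ∑ τ ∈ F, ENNReal.ofReal a := by
          rw [Finset.sum_const, nsmul_eq_mul, mul_comm]
      _ ≤ ∑ τ ∈ F, lengthMeasure ω (A τ) := Finset.sum_le_sum fun τ hτ => hlen τ (hF hτ)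
      _ = lengthMeasure ω (⋃ τ ∈ F, A τ) :=
          (measure_biUnion_finset (hdisj.subset hF) fun τ _ => hmeas τ).symm
      _ ≤ trimLength ω a := measure_mono (iUnion₂_subset fun τ hτ => hsub τ (hF hτ))
  rw [trimLeaves]
  by_cases hf : (leaves (trim ω (2 * a))).Finite
  · rw [hf.encard_eq_coe_toFinset_card]
    exact hfin _ (by simp)
  · have hinf : (leaves (trim ω (2 * a))).Infinite := hf
    suffices trimLength ω a = ⊤ by rw [this]; exact le_top
    refine ENNReal.eq_top_of_forall_nnreal_le fun r => ?_
    obtain ⟨n, hn⟩ := exists_nat_ge (r / a : ℝ)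
    obtain ⟨F, hF, hcard⟩ := hinf.exists_subset_card_eq n
    refine le_trans ?_ (hfin F hF)
    rw [hcard, ← ENNReal.ofReal_coe_nnreal, ← ENNReal.ofReal_natCast, ← ENNReal.ofReal_mul ha.le]
    refine ENNReal.ofReal_le_ofReal ?_
    rwa [div_le_iff₀' ha] at hn

theorem height_root_pos (hω : ¬ ∃ c : ℝ, ∀ t, ω t = c) : 0 < height (root ω) := by
  by_contra! h
  refine hω ⟨ω (argmin ω), fun t => le_antisymm ?_ (argmin_le t)⟩
  have := le_height (mem_above_root (proj ω t))
  rw [level_proj, level_root] at this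
  linarith

/-- The lower half of the arc from the root to a highest point has height at least half that of the
root. So the trimmed length stays away from zero and its exponent is nonnegative. -/
theorem ofReal_le_trimLength {a : ℝ} (ha : 0 < a) (ha' : a ≤ height (root ω) / 2) :
    ENNReal.ofReal (height (root ω) / 2) ≤ trimLength ω a := by
  obtain ⟨σ, -, hσ⟩ := exists_height_eq (root ω)
  rw [trimLength, lengthMeasure_eq_of_subset_trim ha subset_rfl]
  refine le_trans ?_ (le_hausdorffMeasure_of_level (B := Icc (level ω (root ω))
    (level ω (root ω) + height (root ω) / 2)) ?_)
  · rw [Real.volume_Icc]; simp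
  · rintro v ⟨h1, h2⟩
    obtain ⟨τ, hτ, rfl⟩ := exists_below_level_eq σ h1 (by linarith)
    refine ⟨τ, ?_, rfl⟩
    have := le_height hτ
    change a ≤ height τ
    linarith

theorem max_growthExponent_trimLeaves_le (hω : ¬ ∃ c : ℝ, ∀ t, ω t = c) :
    max (growthExponent (fun a => (trimLeaves ω a : ENNReal))) 1 ≤
      growthExponent (trimLength ω) + 1 := by
  have key : ∀ q : ℝ, growthExponent (trimLength ω) < q →
      max (growthExponent (fun a => (trimLeaves ω a : ENNReal))) 1 ≤ ((q + 1 : ℝ) : EReal) := by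
    intro q hq
    have h := eventually_le_of_growthExponent_lt hq
    refine max_le ?_ ?_
    · refine growthExponent_le (C := ENNReal.ofReal ((1 / 2) ^ (-(q + 1)))) ENNReal.ofReal_ne_top ?_
      filter_upwards [eventually_comp_mul (c := 1 / 2) (by norm_num) h, self_mem_nhdsWithin]
        with a ha ha0
      rw [mem_Ioi] at ha0
      have h1 := (ofReal_mul_trimLeaves_le (ω := ω) (a := 1 / 2 * a) (by positivity)).trans ha
      rw [show 2 * (1 / 2 * a) = a by ring] at h1
      rw [← ENNReal.ofReal_mul (by positivity),
        ← Real.mul_rpow (by norm_num) ha0.le, neg_add, Real.rpow_add (by positivity),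
        Real.rpow_neg_one, ENNReal.ofReal_mul (by positivity),
        ENNReal.ofReal_inv_of_pos (by positivity)]
      rw [← div_eq_mul_inv, ENNReal.le_div_iff_mul_le (Or.inl (by simpa using ha0))
        (Or.inl ENNReal.ofReal_ne_top), mul_comm]
      exact h1
    · have := height_root_pos hω
      have h2 : ∀ᶠ a in 𝓝[>] (0 : ℝ), a ∈ Ioo 0 (height (root ω) / 2) :=
        Ioo_mem_nhdsGT (by positivity)
      have h3 : 1 ≤ q + 1 := by
        refine one_le_of_eventually_le (c := height (root ω) / 2) (by positivity) ?_
        filter_upwards [h, h2] with a ha hb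
        have := (ofReal_le_trimLength hb.1 hb.2.le).trans ha
        rw [ENNReal.ofReal_le_ofReal_iff (by have := hb.1; positivity)] at this
        simpa using this
      exact_mod_cast h3
  rw [← EReal.le_of_forall_lt_iff_le]
  intro z hz
  have h1 : growthExponent (trimLength ω) < ((z - 1 : ℝ) : EReal) := by
    rw [EReal.coe_sub, EReal.coe_one]
    exact EReal.lt_sub_iff_add_lt (Or.inl (EReal.coe_ne_bot 1)) (Or.inl (EReal.coe_ne_top 1)) |>.2 hz
  simpa using key _ h1

/-! ### Leaves against covering numbers. -/

theorem coveringNumber_tree_ne_top (ω : C(unitInterval, ℝ)) {r : NNReal} (hr : r ≠ 0) :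
    Metric.coveringNumber r (univ : Set (Tree ω)) ≠ ⊤ := by
  obtain ⟨C, -, hC, hcov⟩ := Metric.exists_finite_isCover_of_isCompact hr
    (isCompact_univ (X := Tree ω))
  have := hcov.coveringNumber_le_encard (subset_univ _)
  exact ne_top_of_le_ne_top (by simpa using hC) this

theorem exists_finset_cover (ω : C(unitInterval, ℝ)) {a : ℝ} (ha : 0 < a) :
    ∃ F : Finset (Tree ω), (∀ τ, ∃ σ ∈ F, dist τ σ ≤ a) ∧
      (F.card : ℕ∞) = Metric.coveringNumber a.toNNReal (univ : Set (Tree ω)) := by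
  have h := coveringNumber_tree_ne_top ω (r := a.toNNReal) (by simpa using ha)
  obtain ⟨C, -, hfin, hcov, hcard⟩ := Metric.exists_set_encard_eq_coveringNumber h
  refine ⟨hfin.toFinset, fun τ => ?_, ?_⟩
  · obtain ⟨σ, hσ, hd⟩ := hcov (mem_univ τ)
    refine ⟨σ, by simpa using hσ, ?_⟩
    change edist τ σ ≤ ENNReal.ofReal a at hd
    rwa [edist_dist, ENNReal.ofReal_le_ofReal_iff ha.le] at hd
  · rw [← hcard, hfin.encard_eq_coe_toFinset_card]

/-- Points chosen on top of distinct leaves of a trimmed tree are separated. -/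
theorem trimLeaves_le_coveringNumber {a : ℝ} (ha : 0 < a) :
    trimLeaves ω (3 * a) ≤ Metric.coveringNumber a.toNNReal (univ : Set (Tree ω)) := by
  choose top htop htop' using fun τ : Tree ω => exists_height_eq τ
  obtain ⟨F, hF, hcard⟩ := exists_finset_cover ω ha
  choose c hc hcd using hF
  rw [trimLeaves, ← hcard, ← Set.encard_coe_eq_coe_finsetCard]
  refine Set.encard_le_encard_of_injOn (f := fun τ => c (top τ)) (fun τ _ => hc _) ?_
  intro τ hτ τ' hτ' heq
  dsimp only at heq
  have h1 := hcd (top τ)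
  have h2 := hcd (top τ')
  rw [← heq] at h2
  have h3 := dist_triangle_right (top τ) (top τ') (c (top τ))
  have h4 := htop' τ
  have h5 := htop' τ'
  have h6 : 3 * a ≤ height τ := hτ.1
  have h7 : 3 * a ≤ height τ' := hτ'.1
  -- The two tops are at distance at most `2 * a`. Incomparable leaves would put them at distance at
  -- least `6 * a`.
  rcases le_total (level ω τ) (level ω τ') with h | h
  · exact (hτ.2 τ' hτ'.1 (mem_above_of_dist_lt (htop τ) (htop τ') h (by linarith))).symm
  · exact hτ'.2 τ hτ.1 (mem_above_of_dist_lt (htop τ') (htop τ) h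
      (by rw [dist_comm]; linarith))

/-- The level map is 1-Lipschitz, so a cover by balls of radius `a` induces a cover of the range of
levels by intervals of length `2 * a`. -/
theorem height_root_le_mul_coveringNumber {a : ℝ} (ha : 0 < a) :
    ENNReal.ofReal (height (root ω)) ≤
      Metric.coveringNumber a.toNNReal (univ : Set (Tree ω)) * ENNReal.ofReal (2 * a) := by
  obtain ⟨F, hF, hcard⟩ := exists_finset_cover ω ha
  obtain ⟨σ, -, hσ⟩ := exists_height_eq (root ω)
  have hsub : Icc (level ω (root ω)) (level ω σ) ⊆
      ⋃ ρ ∈ F, Icc (level ω ρ - a) (level ω ρ + a) := by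
    rintro v ⟨h1, h2⟩
    obtain ⟨τ, -, rfl⟩ := exists_below_level_eq σ h1 h2
    obtain ⟨ρ, hρ, hd⟩ := hF τ
    have := abs_le.1 ((abs_level_sub_le τ ρ).trans hd)
    exact mem_iUnion₂.2 ⟨ρ, hρ, by linarith, by linarith⟩
  have h := (measure_mono (μ := volume) hsub).trans (measure_biUnion_finset_le F _)
  rw [← hcard]
  simp only [Real.volume_Icc, hσ] at h
  refine h.trans_eq ?_
  rw [Finset.sum_congr rfl fun x _ => by rw [show level ω x + a - (level ω x - a) = 2 * a by ring]]
  simp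

theorem max_growthExponent_trimLeaves_le_upperBoxDim (hpos : 0 < height (root ω)) :
    max (growthExponent (fun a => (trimLeaves ω a : ENNReal))) 1 ≤ upperBoxDim (Tree ω) := by
  rw [← EReal.le_of_forall_lt_iff_le]
  intro q hq
  have h := eventually_le_of_growthExponent_lt hq
  refine max_le ?_ ?_
  · refine growthExponent_le (C := ENNReal.ofReal ((1 / 3) ^ (-q))) ENNReal.ofReal_ne_top ?_
    filter_upwards [eventually_comp_mul (c := 1 / 3) (by norm_num) h, self_mem_nhdsWithin]
      with a ha ha0
    rw [mem_Ioi] at ha0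
    rw [← ENNReal.ofReal_mul (by positivity), ← Real.mul_rpow (by norm_num) ha0.le]
    refine le_trans ?_ ha
    have := trimLeaves_le_coveringNumber (ω := ω) (a := 1 / 3 * a) (by positivity)
    rw [show 3 * (1 / 3 * a) = a by ring] at this
    exact_mod_cast this
  · have h3 : 1 ≤ q := by
      refine one_le_of_eventually_le (c := height (root ω) / 2) (by positivity) ?_
      filter_upwards [h, self_mem_nhdsWithin] with a ha ha0
      rw [mem_Ioi] at ha0
      have h1 := (height_root_le_mul_coveringNumber (ω := ω) ha0).trans (mul_le_mul_left ha _)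
      rw [← ENNReal.ofReal_mul (by positivity), ENNReal.ofReal_le_ofReal_iff (by positivity)] at h1
      rw [sub_eq_neg_add, Real.rpow_add ha0, Real.rpow_one]
      linarith
    exact_mod_cast h3

/-! ### The p-variation is bounded by the height integral. -/

/-- The points below `π(hi)`, at a level between `ω lo` and the midpoint of `ω lo` and `ω hi`. -/
def band (ω : C(unitInterval, ℝ)) (lo hi : unitInterval) : Set (Tree ω) :=
  {σ | proj ω hi ∈ above σ} ∩ level ω ⁻¹' (Ioc (ω lo) ((ω lo + ω hi) / 2))

theorem measurableSet_band (lo hi : unitInterval) : MeasurableSet (band ω lo hi) :=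
  (isClosed_below _).measurableSet.inter ((continuous_level ω).measurable measurableSet_Ioc)

theorem band_subset_trim (lo hi : unitInterval) :
    band ω lo hi ⊆ trim ω ((ω hi - ω lo) / 2) := by
  rintro σ ⟨h1, -, h2⟩
  have h3 := le_height h1
  rw [level_proj] at h3
  change _ ≤ height σ
  linarith

/-- A common point `π(r)` lies below both `π(hi)` and `π(hi')`, so the path stays above `ω r`
between these times. But both `ω lo` and `ω lo'` are strictly below `ω r`, which is why bands are
open at the bottom. -/
theorem disjoint_band {lo hi lo' hi' : unitInterval}
    (h : lo ∈ uIcc hi hi' ∨ lo' ∈ uIcc hi hi') : Disjoint (band ω lo hi) (band ω lo' hi') := by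
  refine Set.disjoint_left.2 ?_
  rintro σ ⟨h1, h2, -⟩ ⟨h3, h4, -⟩
  obtain ⟨r, rfl⟩ := exists_proj_eq σ
  rw [level_proj] at h2 h4
  have h1' := proj_mem_above_proj.1 h1
  have h3' := proj_mem_above_proj.1 h3
  have h5 := forall_uIcc_of_forall_uIcc (P := fun u => ω r ≤ ω u)
    (fun u hu => h1' u (by rwa [uIcc_comm])) h3'
  rcases h with h | h
  · exact (h5 _ h).not_gt h2
  · exact (h5 _ h).not_gt h4

theorem rpow_le_lintegral_band {lo hi : unitInterval} (h : ω lo ≤ ω hi) {p : ℝ} (hp : 1 ≤ p) :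
    ENNReal.ofReal ((ω hi - ω lo) ^ p) ≤ ENNReal.ofReal (2 ^ p) *
      ∫⁻ τ in band ω lo hi, ENNReal.ofReal (height τ ^ (p - 1)) ∂(lengthMeasure ω) := by
  rcases h.eq_or_lt with h | h
  · rw [h, sub_self, Real.zero_rpow (by linarith)]
    simp
  obtain ⟨d, hd⟩ : ∃ d, d = (ω hi - ω lo) / 2 := ⟨_, rfl⟩
  have hd0 : 0 < d := by linarith
  have hlen : ENNReal.ofReal d ≤ lengthMeasure ω (band ω lo hi) := by
    rw [lengthMeasure_eq_of_subset_trim (by linarith) (band_subset_trim lo hi)]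
    refine le_trans ?_ (le_hausdorffMeasure_of_level (B := Ioc (ω lo) ((ω lo + ω hi) / 2)) ?_)
    · rw [Real.volume_Ioc]
      exact ENNReal.ofReal_le_ofReal (by linarith)
    · rintro v ⟨hv1, hv2⟩
      obtain ⟨σ, hσ, rfl⟩ := exists_below_level_eq (proj ω hi) (v := v)
        (by rw [level_root]; exact (argmin_le lo).trans hv1.le) (by rw [level_proj]; linarith)
      exact ⟨σ, ⟨hσ, hv1, hv2⟩, rfl⟩
  have hint : ENNReal.ofReal (d ^ (p - 1)) * ENNReal.ofReal d ≤
      ∫⁻ τ in band ω lo hi, ENNReal.ofReal (height τ ^ (p - 1)) ∂(lengthMeasure ω) := by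
    refine (mul_le_mul_right hlen _).trans ?_
    rw [← setLIntegral_const]
    refine setLIntegral_mono' (measurableSet_band lo hi) fun τ hτ => ?_
    have := band_subset_trim lo hi hτ
    rw [← hd] at this
    exact ENNReal.ofReal_le_ofReal (Real.rpow_le_rpow hd0.le this (by linarith))
  refine le_trans (le_of_eq ?_) (mul_le_mul_right hint _)
  rw [← ENNReal.ofReal_mul (by positivity), ← ENNReal.ofReal_mul (by positivity),
    ← Real.rpow_add_one hd0.ne', sub_add_cancel, ← Real.mul_rpow zero_le_two hd0.le, hd]
  congr 2
  ring

theorem sum_rpow_le_lintegral (J : Finset ℕ) (lo hi : ℕ → unitInterval)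
    (hJ : ∀ i ∈ J, ω (lo i) ≤ ω (hi i))
    (h : ∀ i ∈ J, ∀ j ∈ J, i < j → lo i ∈ uIcc (hi i) (hi j) ∨ lo j ∈ uIcc (hi i) (hi j))
    {p : ℝ} (hp : 1 ≤ p) :
    ∑ i ∈ J, ENNReal.ofReal ((ω (hi i) - ω (lo i)) ^ p) ≤ ENNReal.ofReal (2 ^ p) *
      ∫⁻ τ, ENNReal.ofReal (height τ ^ (p - 1)) ∂(lengthMeasure ω) := by
  have hdisj : (J : Set ℕ).PairwiseDisjoint (fun i => band ω (lo i) (hi i)) := by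
    intro i hi j hj hij
    rcases hij.lt_or_gt with hij | hij
    · exact disjoint_band (h i hi j hj hij)
    · exact (disjoint_band (h j hj i hi hij)).symm
  refine (Finset.sum_le_sum fun i hi => rpow_le_lintegral_band (hJ i hi) hp).trans ?_
  rw [← Finset.mul_sum]
  refine mul_le_mul_right ?_ _
  rw [← lintegral_biUnion_finset hdisj fun i _ => measurableSet_band _ _]
  exact setLIntegral_le_lintegral _ _

theorem pVariation_le_lintegral {p : ℝ} (hp : 1 ≤ p) :
    pVariation p ω ≤ 2 * (ENNReal.ofReal (2 ^ p) *
      ∫⁻ τ, ENNReal.ofReal (height τ ^ (p - 1)) ∂(lengthMeasure ω)) := by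
  refine iSup_le fun n => iSup_le fun t => iSup_le fun ht => ?_
  rw [← Finset.sum_filter_add_sum_filter_not _ (fun i => ω (t i) ≤ ω (t (i + 1))), two_mul]
  refine add_le_add ?_ ?_
  · refine le_trans (Finset.sum_le_sum fun i hi => ?_) (sum_rpow_le_lintegral
      ((Finset.range n).filter fun i => ω (t i) ≤ ω (t (i + 1))) t (fun i => t (i + 1))
      (fun i hi => (Finset.mem_filter.1 hi).2) (fun i _ j _ hij => ?_) hp)
    · rw [abs_of_nonneg (sub_nonneg.2 (Finset.mem_filter.1 hi).2)]
    -- For upward moves `i < j`, the later low time `t j` lies between the two high times. For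
    -- downward moves it is the earlier low time `t (i + 1)`.
    · exact Or.inr (Icc_subset_uIcc ⟨ht hij, ht j.le_succ⟩)
  · refine le_trans (Finset.sum_le_sum fun i hi => ?_) (sum_rpow_le_lintegral
      ((Finset.range n).filter fun i => ¬ ω (t i) ≤ ω (t (i + 1))) (fun i => t (i + 1)) t
      (fun i hi => (not_le.1 (Finset.mem_filter.1 hi).2).le) (fun i _ j _ hij => ?_) hp)
    · rw [abs_sub_comm, abs_of_nonneg (sub_nonneg.2 (not_le.1 (Finset.mem_filter.1 hi).2).le)]
    · exact Or.inl (Icc_subset_uIcc ⟨ht i.le_succ, ht hij⟩)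

theorem variationIndex_le_heightIndex : variationIndex ω ≤ heightIndex ω := by
  refine sInf_le_sInf ?_
  rintro _ ⟨p, hp, hint, rfl⟩
  exact ⟨p, hp, (pVariation_le_lintegral hp).trans_lt
    (ENNReal.mul_lt_top (by simp) (ENNReal.mul_lt_top ENNReal.ofReal_lt_top hint)), rfl⟩

/-! ### Covering numbers are bounded by the p-variation. -/

theorem sum_range_two_mul {M : Type*} [AddCommMonoid M] (f : ℕ → M) (n : ℕ) :
    ∑ i ∈ Finset.range (2 * n), f i = ∑ i ∈ Finset.range n, (f (2 * i) + f (2 * i + 1)) := by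
  induction n with
  | zero => simp
  | succ n ih =>
    rw [show 2 * (n + 1) = 2 * n + 1 + 1 by ring, Finset.sum_range_succ, Finset.sum_range_succ, ih,
      Finset.sum_range_succ, add_assoc]

theorem sum_le_pVariation (p : ℝ) (n : ℕ) {t : ℕ → unitInterval} (ht : Monotone t) :
    ∑ i ∈ Finset.range n, ENNReal.ofReal (|ω (t (i + 1)) - ω (t i)| ^ p) ≤ pVariation p ω :=
  le_iSup_of_le n (le_iSup_of_le t (le_iSup_of_le ht le_rfl))

/-- The contribution to the `p`-variation of times whose consecutive projections on the tree are
separated. -/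
theorem mul_rpow_le_pVariation_of_monotone {a p : ℝ} (ha : 0 ≤ a) (hp : 0 ≤ p)
    {t : ℕ → unitInterval} (ht : Monotone t) {M : ℕ}
    (hsep : ∀ i < M, a ≤ delta ω (t i) (t (i + 1))) :
    M * ENNReal.ofReal ((a / 2) ^ p) ≤ pVariation p ω := by
  -- Insert a time of minimum between consecutive times. Then `δ` is the sum of the drop to it and
  -- the rise from it, so one of them is at least `a / 2`.
  choose u hu hu' using fun i => exists_infOn_eq ω (t i) (t (i + 1))
  have hu1 : ∀ i, t i ≤ u i ∧ u i ≤ t (i + 1) := fun i => by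
    simpa [uIcc_of_le (ht i.le_succ)] using hu i
  let v : ℕ → unitInterval := fun n => if n % 2 = 0 then t (n / 2) else u (n / 2)
  have hv0 : ∀ i, v (2 * i) = t i := fun i => by simp [v]
  have hv1 : ∀ i, v (2 * i + 1) = u i := fun i => by
    simp [v, Nat.add_mod, show (2 * i + 1) / 2 = i by omega]
  have hv2 : ∀ i, v (2 * i + 1 + 1) = t (i + 1) := fun i => by
    rw [← hv0]; rfl
  have hv : Monotone v := by
    refine monotone_nat_of_le_succ fun n => ?_
    obtain ⟨i, rfl | rfl⟩ := n.even_or_odd'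
    · rw [hv0, hv1]; exact (hu1 i).1
    · rw [hv1, hv2]; exact (hu1 i).2
  refine le_trans ?_ (sum_le_pVariation p (2 * M) hv)
  rw [sum_range_two_mul, ← Finset.card_range M, ← nsmul_eq_mul, ← Finset.sum_const,
    Finset.card_range]
  refine Finset.sum_le_sum fun i hi => ?_
  have h1 := hsep i (Finset.mem_range.1 hi)
  rw [delta, ← hu' i] at h1
  rw [hv0, hv1, hv2]
  rcases le_or_gt (a / 2) |ω (u i) - ω (t i)| with h | h
  · exact le_add_right (ENNReal.ofReal_le_ofReal (Real.rpow_le_rpow (by linarith) h hp))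
  · refine le_add_left (ENNReal.ofReal_le_ofReal (Real.rpow_le_rpow (by linarith) ?_ hp))
    have := (abs_lt.1 h).1
    exact le_trans (by linarith) (le_abs_self _)

/-- List `T` in increasing order; there is one gap fewer than there are points, whence the
additional term on the right. -/
theorem card_mul_rpow_le_pVariation_add {a p : ℝ} (ha : 0 ≤ a) (hp : 0 ≤ p)
    {T : Finset unitInterval} (hT : ∀ s ∈ T, ∀ t ∈ T, s ≠ t → a ≤ delta ω s t) :
    T.card * ENNReal.ofReal ((a / 2) ^ p) ≤ pVariation p ω + ENNReal.ofReal ((a / 2) ^ p) := by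
  rcases Nat.eq_zero_or_pos T.card with h0 | hpos
  · simp [h0]
  obtain ⟨M, hM⟩ : ∃ M, T.card = M + 1 := ⟨T.card - 1, by omega⟩
  let e := T.orderEmbOfFin hM
  let t : ℕ → unitInterval := fun i => e ⟨min i M, by omega⟩
  have ht : Monotone t := fun i j hij => e.monotone (Fin.mk_le_mk.2 (min_le_min_right M hij))
  have hmem : ∀ i, t i ∈ T := fun i => T.orderEmbOfFin_mem hM _
  have := mul_rpow_le_pVariation_of_monotone (ω := ω) ha hp ht (M := M) fun i hi => by
    refine hT _ (hmem i) _ (hmem _) fun h => ?_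
    have := Fin.mk.inj_iff.1 (e.injective h)
    omega
  rw [hM]
  push_cast
  rw [add_mul, one_mul]
  exact add_le_add_left this _

/-- A largest separated set has at least as many points as a minimal cover; lifting it to times
gives a δ-separated set. -/
theorem coveringNumber_mul_rpow_le {a p : ℝ} (ha : 0 < a) (hp : 0 ≤ p) :
    (Metric.coveringNumber a.toNNReal (univ : Set (Tree ω)) : ENNReal) *
      ENNReal.ofReal ((a / 2) ^ p) ≤ pVariation p ω + ENNReal.ofReal ((a / 2) ^ p) := by
  have hfin : Metric.packingNumber a.toNNReal (univ : Set (Tree ω)) ≠ ⊤ := by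
    have h := (Metric.packingNumber_two_mul_le_externalCoveringNumber (a / 2).toNNReal
      (univ : Set (Tree ω))).trans (Metric.externalCoveringNumber_le_coveringNumber _ _)
    have h2 : 2 * (a / 2).toNNReal = a.toNNReal := by
      rw [← NNReal.coe_inj]
      push_cast
      rw [Real.coe_toNNReal _ ha.le, Real.coe_toNNReal _ (by positivity)]
      ring
    rw [h2] at h
    exact ne_top_of_le_ne_top (coveringNumber_tree_ne_top ω (by simpa using ha)) h
  obtain ⟨C, -, hC, hsep, hcard⟩ := Metric.exists_set_encard_eq_packingNumber hfin
  choose g hg using exists_proj_eq (ω := ω)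
  have hinj : Function.Injective g := fun x y h => by rw [← hg x, ← hg y, h]
  have h := card_mul_rpow_le_pVariation_add (ω := ω) ha.le hp (T := hC.toFinset.image g) ?_
  · rw [Finset.card_image_of_injective _ hinj] at h
    refine le_trans (mul_le_mul_left ?_ _) h
    have h1 := (Metric.coveringNumber_le_packingNumber a.toNNReal (univ : Set (Tree ω))).trans_eq
      hcard.symm
    rw [hC.encard_eq_coe_toFinset_card] at h1
    exact_mod_cast h1
  · simp only [Finset.mem_image, Finite.mem_toFinset]
    rintro _ ⟨x, hx, rfl⟩ _ ⟨y, hy, rfl⟩ hne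
    have h1 := hsep hx hy fun h => hne (h ▸ rfl)
    change ENNReal.ofReal a < edist x y at h1
    rw [edist_dist, ENNReal.ofReal_lt_ofReal_iff_of_nonneg ha.le] at h1
    rw [← dist_proj, hg, hg]
    exact h1.le

theorem upperBoxDim_le_variationIndex : upperBoxDim (Tree ω) ≤ variationIndex ω := by
  refine le_sInf ?_
  rintro _ ⟨p, hp, hV, rfl⟩
  refine growthExponent_le (C := (pVariation p ω + 1) * ENNReal.ofReal (2 ^ p))
    (ENNReal.mul_ne_top (by simpa using hV.ne) ENNReal.ofReal_ne_top) ?_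
  filter_upwards [Ioo_mem_nhdsGT one_pos] with a ha
  have ha0 := ha.1
  have hpos : 0 < (a / 2) ^ p := by positivity
  have h := coveringNumber_mul_rpow_le (ω := ω) ha0 (zero_le_one.trans hp)
  have h1 : ENNReal.ofReal ((a / 2) ^ p) ≤ 1 :=
    ENNReal.ofReal_le_one.2 (Real.rpow_le_one (by linarith) (by linarith [ha.2]) (by linarith))
  have h2 : 2 ^ p * a ^ (-p) = ((a / 2) ^ p)⁻¹ := by
    rw [Real.div_rpow ha0.le zero_le_two, Real.rpow_neg ha0.le, inv_div, div_eq_mul_inv]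
  rw [mul_assoc, ← ENNReal.ofReal_mul (by positivity), h2, ENNReal.ofReal_inv_of_pos hpos,
    ← div_eq_mul_inv, ENNReal.le_div_iff_mul_le (Or.inl (by simpa using hpos))
    (Or.inl ENNReal.ofReal_ne_top)]
  exact h.trans (add_le_add_right h1 _)

/-! ### The height integral is bounded by the number of leaves. -/

theorem trimLeaves_ne_top {a : ℝ} (ha : 0 < a) : trimLeaves ω a ≠ ⊤ := by
  have h := trimLeaves_le_coveringNumber (ω := ω) (a := a / 3) (by positivity)
  rw [mul_div_cancel₀ a three_ne_zero] at h
  exact ne_top_of_le_ne_top (coveringNumber_tree_ne_top ω (by simpa using ha)) h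

/-- A point of height less than `2 * a` has a leaf of the trimmed tree above it, itself of height at
least `a`, so it is less than `a` below that leaf. -/
theorem hausdorffMeasure_trim_diff_le {a : ℝ} (ha : 0 < a) :
    Measure.hausdorffMeasure 1 (trim ω a \ trim ω (2 * a)) ≤
      (trimLeaves ω a : ENNReal) * ENNReal.ofReal a := by
  have hfin : (leaves (trim ω a)).Finite := Set.encard_ne_top_iff.1 (trimLeaves_ne_top ha)
  have hsub : trim ω a \ trim ω (2 * a) ⊆ ⋃ τ ∈ hfin.toFinset,
      ({σ | τ ∈ above σ} ∩ level ω ⁻¹' Ioc (level ω τ - a) (level ω τ)) := by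
    rintro σ ⟨h1, h2⟩
    obtain ⟨τ, hτ, hστ⟩ := exists_leaf_above h1
    have h3 := add_height_le hστ
    have h4 : a ≤ height τ := hτ.1
    have h5 : height σ < 2 * a := not_le.1 h2
    exact mem_iUnion₂.2 ⟨τ, by simpa using hτ, hστ, by linarith, level_le_of_mem_above hστ⟩
  refine (measure_mono hsub).trans ((measure_biUnion_finset_le _ _).trans ?_)
  rw [trimLeaves, hfin.encard_eq_coe_toFinset_card]
  refine (Finset.sum_le_card_nsmul _ _ (ENNReal.ofReal a) fun τ _ => ?_).trans_eq (by simp)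
  refine (hausdorffMeasure_le_of_below (B := Ioc (level ω τ - a) (level ω τ))
    (fun σ hσ => hσ.1) fun σ hσ => hσ.2).trans_eq ?_
  rw [Real.volume_Ioc, sub_sub_cancel]

theorem setLIntegral_trim_diff_le {a p : ℝ} (ha : 0 < a) (hp : 1 ≤ p) :
    ∫⁻ τ in trim ω a \ trim ω (2 * a), ENNReal.ofReal (height τ ^ (p - 1))
      ∂(Measure.hausdorffMeasure 1) ≤
    ENNReal.ofReal ((2 * a) ^ (p - 1)) * ((trimLeaves ω a : ENNReal) * ENNReal.ofReal a) := by
  refine le_trans ?_ (mul_le_mul_right (hausdorffMeasure_trim_diff_le ha) _)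
  rw [← setLIntegral_const]
  refine setLIntegral_mono' ((measurableSet_trim ω a).diff (measurableSet_trim ω (2 * a)))
    fun τ hτ => ENNReal.ofReal_le_ofReal ?_
  exact Real.rpow_le_rpow (height_nonneg τ) (not_le.1 hτ.2).le (by linarith)

theorem skeleton_subset_iUnion_trim_diff {D : ℝ} (hD : height (root ω) ≤ D) (hD0 : 0 < D) :
    skeleton ω ⊆ ⋃ k : ℕ, trim ω (D * (1 / 2) ^ k) \ trim ω (2 * (D * (1 / 2) ^ k)) := by
  intro τ hτ
  rw [skeleton_eq] at hτ
  have hτ : 0 < height τ := hτ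
  have hex : ∃ k : ℕ, D * (1 / 2) ^ k ≤ height τ := by
    obtain ⟨k, hk⟩ := exists_pow_lt_of_lt_one (y := (1 / 2 : ℝ)) (div_pos hτ hD0) (by norm_num)
    rw [lt_div_iff₀' hD0] at hk
    exact ⟨k, hk.le⟩
  classical
  -- For the least such `k`, minimality gives the upper bound if `k > 0`; if `k = 0`, it comes from
  -- `height τ ≤ D < 2 * D`.
  refine mem_iUnion.2 ⟨Nat.find hex, Nat.find_spec hex, ?_⟩
  change ¬ _ ≤ height τ
  rcases h : Nat.find hex with _ | k
  · have := height_le_height_root τ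
    rw [pow_zero]
    linarith
  · have := Nat.find_min hex (m := k) (by omega)
    rw [pow_succ]
    linarith

/-- At scale `b`, the slice contributes at most a constant times `b ^ (p - 1) * b ^ (-q) * b = b ^
(p - q)` once `b` is small, and this is summable over dyadic scales. The finitely many larger scales
contribute finite terms. -/
theorem lintegral_height_rpow_lt_top (hpos : 0 < height (root ω)) {p q : ℝ} (hp : 1 ≤ p)
    (hqp : q < p) (hq : growthExponent (fun a => (trimLeaves ω a : ENNReal)) < q) :
    ∫⁻ τ, ENNReal.ofReal (height τ ^ (p - 1)) ∂(lengthMeasure ω) < ⊤ := by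
  obtain ⟨D, hD⟩ : ∃ D, D = height (root ω) := ⟨_, rfl⟩
  have hD0 : 0 < D := hD ▸ hpos
  let b : ℕ → ℝ := fun k => D * (1 / 2) ^ k
  have hb : ∀ k, 0 < b k := fun k => by positivity
  let u : ℕ → ENNReal := fun k =>
    ENNReal.ofReal ((2 * b k) ^ (p - 1)) * ((trimLeaves ω (b k) : ENNReal) * ENNReal.ofReal (b k))
  have hle : ∫⁻ τ, ENNReal.ofReal (height τ ^ (p - 1)) ∂(lengthMeasure ω) ≤ ∑' k, u k := by
    rw [lengthMeasure]
    refine (lintegral_mono_set (skeleton_subset_iUnion_trim_diff hD.ge hD0)).trans ?_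
    refine (lintegral_iUnion_le _ _).trans ?_
    exact ENNReal.tsum_le_tsum fun k => setLIntegral_trim_diff_le (hb k) hp
  have hu : ∀ k, u k ≠ ⊤ := fun k => by
    have := trimLeaves_ne_top (ω := ω) (hb k)
    exact ENNReal.mul_ne_top ENNReal.ofReal_ne_top
      (ENNReal.mul_ne_top (by simpa using this) ENNReal.ofReal_ne_top)
  have hlim : Tendsto b atTop (𝓝[>] 0) := by
    refine tendsto_nhdsWithin_iff.2 ⟨?_, Eventually.of_forall hb⟩
    have := (tendsto_pow_atTop_nhds_zero_of_lt_one (r := (1 / 2 : ℝ)) (by norm_num)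
      (by norm_num)).const_mul D
    rwa [mul_zero] at this
  obtain ⟨K, hK⟩ := eventually_atTop.1 (hlim.eventually (eventually_le_of_growthExponent_lt hq))
  let C : ℝ := 2 ^ (p - 1) * D ^ (p - q)
  let r : ℝ := (1 / 2) ^ (p - q)
  have hr1 : r < 1 := Real.rpow_lt_one (by norm_num) (by norm_num) (by linarith)
  have hr0 : 0 ≤ r := by positivity
  have htail : ∀ k, u (k + K) ≤ ENNReal.ofReal (C * r ^ (k + K)) := fun k => by
    have h1 := hK (k + K) (by omega)
    have h2 := hb (k + K)
    refine (mul_le_mul_right (mul_le_mul_left h1 _) _).trans_eq ?_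
    rw [← ENNReal.ofReal_mul (by positivity), ← ENNReal.ofReal_mul (by positivity)]
    congr 1
    have h3 : b (k + K) ^ (p - q) = D ^ (p - q) * r ^ (k + K) := by
      simp only [b, r]
      rw [Real.mul_rpow hD0.le (by positivity), ← Real.rpow_natCast, ← Real.rpow_natCast,
        ← Real.rpow_mul (by norm_num), ← Real.rpow_mul (by norm_num), mul_comm (p - q)]
    have h4 : b (k + K) ^ (p - 1) * (b (k + K) ^ (-q) * b (k + K)) = b (k + K) ^ (p - q) := by
      rw [← Real.rpow_add_one h2.ne', ← Real.rpow_add h2]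
      congr 1
      ring
    rw [Real.mul_rpow zero_le_two h2.le, mul_assoc, h4, h3]
    simp only [C]
    ring
  have hsum : Summable fun k : ℕ => C * r ^ (k + K) :=
    ((summable_nat_add_iff K).2 (summable_geometric_of_lt_one hr0 hr1)).mul_left C
  refine hle.trans_lt ?_
  rw [← Summable.sum_add_tsum_nat_add' (k := K) ENNReal.summable]
  refine ENNReal.add_lt_top.2 ⟨ENNReal.sum_lt_top.2 fun k _ => (hu k).lt_top, ?_⟩
  exact (ENNReal.tsum_le_tsum htail).trans_lt hsum.tsum_ofReal_lt_top

theorem heightIndex_le (hpos : 0 < height (root ω)) :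
    heightIndex ω ≤ max (growthExponent (fun a => (trimLeaves ω a : ENNReal))) 1 := by
  rw [← EReal.le_of_forall_lt_iff_le]
  intro p hp
  obtain ⟨h1, h2⟩ := max_lt_iff.1 hp
  obtain ⟨q, hq1, hq2⟩ := EReal.lt_iff_exists_real_btwn.1 h1
  have hp1 : 1 ≤ p := by exact_mod_cast h2.le
  exact sInf_le ⟨p, hp1, lintegral_height_rpow_lt_top hpos hp1 (by exact_mod_cast hq2) hq1, rfl⟩

/-! ### Finiteness of the p-variation on either side of the index. -/

/-- Increments are bounded by the oscillation of the path, which is the height of the root. Hence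
finiteness passes from an exponent to all larger ones. -/
theorem pVariation_le_mul {p q : ℝ} (hq : 0 < q) (hqp : q ≤ p) :
    pVariation p ω ≤ ENNReal.ofReal (height (root ω) ^ (p - q)) * pVariation q ω := by
  refine iSup_le fun n => iSup_le fun t => iSup_le fun ht => ?_
  refine le_trans ?_ (mul_le_mul_right (sum_le_pVariation q n ht) _)
  rw [Finset.mul_sum]
  refine Finset.sum_le_sum fun i _ => ?_
  have hD := height_nonneg (root ω)
  rw [← ENNReal.ofReal_mul (by positivity)]
  refine ENNReal.ofReal_le_ofReal ?_
  have hb : ∀ t, ω (argmin ω) ≤ ω t ∧ ω t ≤ ω (argmin ω) + height (root ω) := fun t => by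
    have := le_height (mem_above_root (proj ω t))
    rw [level_proj, level_root] at this
    exact ⟨argmin_le t, by linarith⟩
  have habs : |ω (t (i + 1)) - ω (t i)| ≤ height (root ω) := by
    have h1 := hb (t i)
    have h2 := hb (t (i + 1))
    exact abs_le.2 ⟨by linarith, by linarith⟩
  calc |ω (t (i + 1)) - ω (t i)| ^ p
      = |ω (t (i + 1)) - ω (t i)| ^ (p - q) * |ω (t (i + 1)) - ω (t i)| ^ q := by
        rw [← Real.rpow_add_of_nonneg (abs_nonneg _) (by linarith) hq.le, sub_add_cancel]
    _ ≤ _ := by gcongr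

theorem pVariation_lt_top_of_variationIndex_lt {p : ℝ} (h : variationIndex ω < p) :
    pVariation p ω < ⊤ := by
  obtain ⟨_, ⟨q, hq1, hq, rfl⟩, hqp⟩ := sInf_lt_iff.1 h
  exact (pVariation_le_mul (by linarith) (by exact_mod_cast hqp.le)).trans_lt
    (ENNReal.mul_lt_top ENNReal.ofReal_lt_top hq)

theorem pVariation_eq_top_of_lt_variationIndex {p : ℝ} (hp : 1 ≤ p)
    (h : (p : EReal) < variationIndex ω) : pVariation p ω = ⊤ := by
  by_contra hne
  exact h.not_ge (sInf_le ⟨p, hp, lt_top_iff_ne_top.2 hne, rfl⟩)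

end PathTree

theorem mainTheorem1 (ω : C(unitInterval, ℝ)) (hω : ¬ ∃ c : ℝ, ∀ t, ω t = c) :
    PathTree.variationIndex ω = PathTree.heightIndex ω ∧
    PathTree.variationIndex ω = PathTree.growthExponent (PathTree.trimLength ω) + 1 ∧
    PathTree.variationIndex ω =
      max (PathTree.growthExponent (fun a => (PathTree.trimLeaves ω a : ENNReal))) 1 ∧
    PathTree.variationIndex ω = PathTree.upperBoxDim (PathTree.Tree ω) ∧
    (∀ p : ℝ, 1 ≤ p → (p : EReal) < PathTree.upperBoxDim (PathTree.Tree ω) →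
      PathTree.pVariation p ω = ⊤) ∧
    (∀ p : ℝ, PathTree.upperBoxDim (PathTree.Tree ω) < (p : EReal) →
      PathTree.pVariation p ω < ⊤) := by
  have hpos := PathTree.height_root_pos hω
  have hVH := PathTree.variationIndex_le_heightIndex (ω := ω)
  have hHN := PathTree.heightIndex_le hpos
  have hND := PathTree.max_growthExponent_trimLeaves_le_upperBoxDim hpos
  have hDV := PathTree.upperBoxDim_le_variationIndex (ω := ω)
  have hNL := PathTree.max_growthExponent_trimLeaves_le hω
  have hLH := PathTree.growthExponent_trimLength_add_one_le (ω := ω)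
  have hD : PathTree.variationIndex ω = PathTree.upperBoxDim (PathTree.Tree ω) :=
    le_antisymm (hVH.trans (hHN.trans hND)) hDV
  refine ⟨le_antisymm hVH (hHN.trans (hND.trans hDV)), le_antisymm (hVH.trans (hHN.trans hNL))
    (hLH.trans (hHN.trans (hND.trans hDV))), le_antisymm (hVH.trans hHN) (hND.trans hDV), hD,
    fun p hp h => ?_, fun p h => ?_⟩
  · exact PathTree.pVariation_eq_top_of_lt_variationIndex hp (hD ▸ h)
  · exact PathTree.pVariation_lt_top_of_variationIndex_lt (hD ▸ h)
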